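/- **Setting.** Consider a PDE system $G^a(t,x,u,\partial u,\partial^2u,\dots)=0$, $a=1,\dots,M$, for functions $u=(u^1,\dots,u^m)$ of $t$ (in an open interval $I$) and $x\in\mathbb R^3$. A *differential function* $f[u]$ is a smooth function of $t$, $x$ and finitely many partial derivatives of $u$ (on a given open domain of jet space on which the $G^a$ are also smooth). $D_t$, $\operatorname{Grad}$, $\operatorname{Curl}$ are formed with total derivatives. Let $\mathcal E$ be the set of smooth solutions $u$ on $I\times\mathbb R^3$; $f|_{\mathcal E}=g|_{\mathcal E}$ means $f[u]=g[u]$ for all $u\in\mathcal E$. A *local surface-flux conservation law* is a pair of vector differential functions $(T,X)$ with $(D_tT+\operatorname{Curl}X)|_{\mathcal E}=0$. It is *locally trivial* if there are a vector differential function $\Theta$ and a scalar differential function $\Lambda$ with $$T|_{\mathcal E}=\operatorname{Curl}\Theta|_{\mathcal E},\qquad X|_{\mathcal E}=(-D_t\Theta+\operatorname{Grad}\Lambda)|_{\mathcal E}.\tag{1}$$ A *regular surface* $S\subset\mathbb R^3$ is a compact connected oriented piecewise-smooth embedded surface with (possibly empty) piecewise-smooth boundary $\partial S$ carrying the induced orientation;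 $S$ is *closed* if $\partial S=\emptyset$. A quantity $C[u](t)$ is a *constant of motion* if $\frac{d}{dt}C[u](t)=0$ for all $u\in\mathcal E$, $t\in I$; it is *identically zero* if $C[u](t)=0$ for all $u\in\mathcal E$, $t\in I$; it is *time dependent* (for an arbitrary solution) if it is not the case that $C[u](t)$ is independent of $t$ for every $u\in\mathcal E$. The law is *globally trivial on $S$* if the conserved integral $\int_S T[u]\cdot dS$ contains no local and no global information about solutions: the law is locally trivial, and $\int_S T[u]\cdot dS$ is not a constant of motion, unless it is identically zero. A *non-trivial circulatory constant of motion on $\partial S$* with density $\Theta$ is a constant of motion $\oint_{\partial S}\Theta[u]\cdot ds$ that is not identically zero and whose density is not of the form $\Theta|_{\mathcal E}=\operatorname{Grad}\Xi|_{\mathcal E}$ for any scalar differential function $\Xi$. **Proposition.** Let $(T,X)$ be a locally trivial surface-flux conservation law of the system, with potentials $\Theta,\Lambda$ as in (1). (i) For every regular surface $S$, the law is globally trivial on $S$ if and only if either $S$ is closed, or $S$ is non-closed and the circulation integral $\oint_{\partial S}\Theta[u]\cdot ds$ is time dependent or identically zero. (ii) If the law is globally non-trivial on every non-closed regular surface,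 then it corresponds to the purely temporal curl-type conservation law $$D_t\operatorname{Curl}\Theta\,|_{\mathcal E}=0,$$ and this yields a circulatory constant of motion: for every non-closed regular surface $S$, $\int_S T[u]\cdot dS=\oint_{\partial S}\Theta[u]\cdot ds$ for all $u\in\mathcal E$ and $t\in I$, and $\oint_{\partial S}\Theta[u]\cdot ds$ is a non-trivial circulatory constant of motion on $\partial S$. -/

import Mathlib

open scoped ContDiff Matrix

noncomputable section

namespace SurfaceFlux

/-! ### Jet space and differential functions -/

/-- Spacetime: the coordinate `0` is the time `t`, the coordinates `1, 2, 3` are `x¹, x², x³`. -/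
abbrev Spacetime := Fin 4 → ℝ

/-- Euclidean space with Cartesian coordinates. -/
abbrev Space := Fin 3 → ℝ

/-- The spacetime point `(t, x)`. -/
def spacetimePoint (t : ℝ) (x : Space) : Spacetime := Fin.cons t x

/-- Multi-indices: `K i` is the number of differentiations in the `i`-th spacetime coordinate. -/
abbrev MultiIndex := Fin 4 → ℕ

/-- The jet space of `m` dependent variables: a point `w` consists of the independent variables
`w.1` and, for each `α` and each multi-index `K`, the value `w.2 (α, K)` of `∂^K u^α`. -/
abbrev Jet (m : ℕ) := Spacetime × (Fin m × MultiIndex → ℝ)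

/-- The independent variables together with the finitely many derivative variables in `s`. -/
def Jet.restrict {m : ℕ} (s : Finset (Fin m × MultiIndex)) (w : Jet m) :
    Spacetime × (s → ℝ) :=
  (w.1, fun k => w.2 k)

/-- `f` is a (scalar) differential function on the open domain `D` of jet space: on `D` it is a
smooth function of finitely many jet variables. -/
def IsDiffFun {m : ℕ} (D : Set (Jet m)) (f : Jet m → ℝ) : Prop :=
  ∃ (s : Finset (Fin m × MultiIndex)) (g : Spacetime × (s → ℝ) → ℝ),
    ContDiffOn ℝ ∞ g (Jet.restrict s '' D) ∧ ∀ w ∈ D, f w = g (Jet.restrict s w)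

/-- A vector differential function on `D`. -/
def IsVecDiffFun {m : ℕ} (D : Set (Jet m)) (f : Jet m → Space) : Prop :=
  ∀ j, IsDiffFun D (fun w => f w j)

/-- The total derivative
`D_i f = ∂f/∂z^i + ∑_{α, K} u^α_{K + e_i} ∂f/∂u^α_K`,
written as the derivative of `f` along the corresponding vector field on jet space. -/
def totalDeriv {m : ℕ} (i : Fin 4) (f : Jet m → ℝ) : Jet m → ℝ := fun w =>
  lineDeriv ℝ f w (Pi.single i 1, fun k => w.2 (k.1, k.2 + Pi.single i 1))

/-- The total time derivative of a vector differential function. -/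
def totalDt {m : ℕ} (f : Jet m → Space) : Jet m → Space := fun w j =>
  totalDeriv 0 (fun v => f v j) w

/-- The total gradient. -/
def Grad {m : ℕ} (f : Jet m → ℝ) : Jet m → Space := fun w =>
  ![totalDeriv 1 f w, totalDeriv 2 f w, totalDeriv 3 f w]

/-- The total curl. -/
def Curl {m : ℕ} (f : Jet m → Space) : Jet m → Space := fun w =>
  ![totalDeriv 2 (fun v => f v 2) w - totalDeriv 3 (fun v => f v 1) w,
    totalDeriv 3 (fun v => f v 0) w - totalDeriv 1 (fun v => f v 2) w,
    totalDeriv 1 (fun v => f v 1) w - totalDeriv 2 (fun v => f v 0) w]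

/-- The partial derivative of a function on spacetime. -/
def partialDeriv (i : Fin 4) (h : Spacetime → ℝ) : Spacetime → ℝ := fun z =>
  fderiv ℝ h z (Pi.single i 1)

/-- The mixed partial derivative `∂^K h`. -/
def mixedPartial (K : MultiIndex) (h : Spacetime → ℝ) : Spacetime → ℝ :=
  (partialDeriv 0)^[K 0] ((partialDeriv 1)^[K 1] ((partialDeriv 2)^[K 2]
    ((partialDeriv 3)^[K 3] h)))

/-- The jet at `z` of a function `u` on spacetime. -/
def jet {m : ℕ} (u : Spacetime → Fin m → ℝ) (z : Spacetime) : Jet m :=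
  (z, fun k => mixedPartial k.2 (fun y => u y k.1) z)

/-! ### PDE systems and their solutions -/

/-- A PDE system `G^a[u] = 0`, `a = 1, …, M`, on `ℝ³` for `m` dependent variables. The `G^a` are
differential functions on an open domain of jet space (for instance the jets with positive
density), and solutions are considered for times in a fixed open interval. -/
structure PDESystem (m : ℕ) where
  time : Set ℝ
  time_open : IsOpen time
  time_interval : time.OrdConnected
  time_nonempty : time.Nonempty
  dom : Set (Jet m)
  dom_open : IsOpen dom
  numEqs : ℕ
  eqn : Fin numEqs → Jet m → ℝ
  eqn_diffFun : ∀ a, IsDiffFun dom (eqn a)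

namespace PDESystem

variable {m : ℕ} (P : PDESystem m)

/-- The spacetime domain: all points `(t, x)` with `t` in the time interval. -/
def slab : Set Spacetime := {z | z 0 ∈ P.time}

/-- The solution space of the system: all smooth solutions `u(t, x)`. -/
def solutions : Set (Spacetime → Fin m → ℝ) :=
  {u | ContDiffOn ℝ ∞ u P.slab ∧
    ∀ z ∈ P.slab, jet u z ∈ P.dom ∧ ∀ a, P.eqn a (jet u z) = 0}

/-- `f[u] = g[u]` for all solutions `u` of the system. -/
def EqOnSolutions {β : Type} (f g : Jet m → β) : Prop :=
  ∀ u ∈ P.solutions, ∀ z ∈ P.slab, f (jet u z) = g (jet u z)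

end PDESystem

/-! ### Regular surfaces -/

/-- The unit square. -/
def unitSquare : Set (ℝ × ℝ) := Set.Icc 0 1 ×ˢ Set.Icc 0 1

/-- The corners of the unit square. -/
def corners : Set (ℝ × ℝ) := {(0, 0), (1, 0), (1, 1), (0, 1)}

/-- The four sides of the unit square, traversed counterclockwise. -/
def side : Fin 4 → ℝ → ℝ × ℝ :=
  ![fun s => (s, 0), fun s => (1, s), fun s => (1 - s, 1), fun s => (0, 1 - s)]

/-- A regular surface: a compact connected oriented piecewise-smooth surface in `ℝ³`, with or
without boundary, presented as finitely many smooth embedded square patches glued along edges.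

Each patch is oriented by the normal `∂₁σ × ∂₂σ`. The edge `(i, k)` is the `k`-th side of the
patch `i`. The involution `glue` lists the pairs of edges that are identified; they are traversed
in opposite directions, so that the orientations of neighbouring patches agree. The fixed points of
`glue` are the free edges, which form the boundary curves. By `meet`, patches that
have a point `p` in common are linked around `p` by a chain of patches glued along edges through
`p`; hence patches meet only along glued edges and their end points, and the patches at an interior
(boundary) vertex form a disc (half-disc), so that the union of the patches is an embedded
topological surface with boundary. -/
structure RegularSurface where
  n : ℕ
  patch : Fin n → ℝ × ℝ → Space
  smooth : ∀ i, ContDiff ℝ ∞ (patch i)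
  injective : ∀ i, Set.InjOn (patch i) unitSquare
  immersive : ∀ i, ∀ p ∈ unitSquare \ corners, Function.Injective (fderiv ℝ (patch i) p)
  glue : Fin n × Fin 4 → Fin n × Fin 4
  glue_glue : ∀ a, glue (glue a) = a
  glue_edge : ∀ a, glue a ≠ a → ∀ s ∈ Set.Icc (0 : ℝ) 1,
    patch (glue a).1 (side (glue a).2 s) = patch a.1 (side a.2 (1 - s))
  meet : ∀ i j, ∀ p ∈ patch i '' unitSquare ∩ patch j '' unitSquare,
    Relation.ReflTransGen (fun i' j' => ∃ k l, glue (i', k) = (j', l) ∧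
      ∃ s ∈ Set.Icc (0 : ℝ) 1, patch i' (side k s) = p) i j
  connected : IsConnected (⋃ i, patch i '' unitSquare)

namespace RegularSurface

variable (S : RegularSurface)

/-- The surface is closed: its boundary is empty. -/
def Closed : Prop := ∀ a, S.glue a ≠ a

/-- The surface integral `∫_S F · dS`. -/
def surfaceIntegral (F : Space → Space) : ℝ :=
  ∑ i, ∫ p in unitSquare, F (S.patch i p) ⬝ᵥ
    ((fderiv ℝ (S.patch i) p (1, 0)) ⨯₃ (fderiv ℝ (S.patch i) p (0, 1)))

open scoped Classical in
/-- The line integral `∮_{∂S} F · ds` over the boundary curve or curves, with the orientation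
induced by that of the surface. -/
def boundaryIntegral (F : Space → Space) : ℝ :=
  ∑ a with S.glue a = a, ∫ s in (0 : ℝ)..1,
    F (S.patch a.1 (side a.2 s)) ⬝ᵥ deriv (fun r => S.patch a.1 (side a.2 r)) s

/-- `∫_S f[u] · dS` at time `t`. -/
def fluxThrough {m : ℕ} (f : Jet m → Space) (u : Spacetime → Fin m → ℝ) (t : ℝ) : ℝ :=
  S.surfaceIntegral fun x => f (jet u (spacetimePoint t x))

/-- `∮_{∂S} f[u] · ds` at time `t`. -/
def circulation {m : ℕ} (f : Jet m → Space) (u : Spacetime → Fin m → ℝ) (t : ℝ) : ℝ :=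
  S.boundaryIntegral fun x => f (jet u (spacetimePoint t x))

end RegularSurface

/-! ### Conservation laws and their triviality -/

namespace PDESystem

variable {m : ℕ} (P : PDESystem m)

/-- `(T, X)` is the conserved flux current of a local surface-flux conservation law:
`D_t T + Curl X = 0` on all solutions. -/
def IsSurfaceFluxLaw (T X : Jet m → Space) : Prop :=
  IsVecDiffFun P.dom T ∧ IsVecDiffFun P.dom X ∧
    P.EqOnSolutions (fun w => totalDt T w + Curl X w) 0

/-- `(T, X)` has the locally trivial form `T = Curl Θ`, `X = -D_t Θ + Grad Λ` on all solutions,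
with the given potentials. -/
def HasTrivialForm (T X Θ : Jet m → Space) (Λ : Jet m → ℝ) : Prop :=
  IsVecDiffFun P.dom Θ ∧ IsDiffFun P.dom Λ ∧
    P.EqOnSolutions T (Curl Θ) ∧
    P.EqOnSolutions X (fun w => -totalDt Θ w + Grad Λ w)

/-- Local triviality of a surface-flux conservation law. -/
def LocallyTrivial (T X : Jet m → Space) : Prop :=
  ∃ Θ Λ, P.HasTrivialForm T X Θ Λ

/-- The quantity `C[u](t)` is a constant of motion: `dC/dt = 0` for all solutions. -/
def IsConstantOfMotion (C : (Spacetime → Fin m → ℝ) → ℝ → ℝ) : Prop :=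
  ∀ u ∈ P.solutions, ∀ t ∈ P.time, HasDerivAt (C u) 0 t

/-- The quantity `C[u](t)` vanishes identically, for all solutions at all times. -/
def IdenticallyZero (C : (Spacetime → Fin m → ℝ) → ℝ → ℝ) : Prop :=
  ∀ u ∈ P.solutions, ∀ t ∈ P.time, C u t = 0

/-- The quantity `C[u](t)` is time dependent, as a quantity on the solution space: it is not the
case that it is independent of time for every solution. -/
def TimeDependent (C : (Spacetime → Fin m → ℝ) → ℝ → ℝ) : Prop :=
  ∃ u ∈ P.solutions, ∃ t₁ ∈ P.time, ∃ t₂ ∈ P.time, C u t₁ ≠ C u t₂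

/-- Global triviality of a surface-flux conservation law on the surface `S`: the conserved integral
`∫_S T · dS` contains no information about the solutions. It contains no local information, that is,
the law is locally trivial; and it contains no global information, that is, it does not provide a
constant of motion other than one that vanishes identically. -/
def GloballyTrivial (T X : Jet m → Space) (S : RegularSurface) : Prop :=
  P.LocallyTrivial T X ∧
    (P.IsConstantOfMotion (S.fluxThrough T) → P.IdenticallyZero (S.fluxThrough T))

/-- The circulation of `Θ` around the boundary of `S` is a non-trivial circulatory constant of
motion: it is conserved, it does not vanish identically, and its density is not locally trivial,
that is, it is not a total gradient on the solution space. -/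
def IsNontrivialCirculatoryConstant (Θ : Jet m → Space) (S : RegularSurface) : Prop :=
  P.IsConstantOfMotion (S.circulation Θ) ∧
    ¬ P.IdenticallyZero (S.circulation Θ) ∧
    ¬ ∃ Ξ : Jet m → ℝ, IsDiffFun P.dom Ξ ∧ P.EqOnSolutions Θ (Grad Ξ)

end PDESystem

end SurfaceFlux

end

open scoped ContDiff Matrix

noncomputable section

namespace SurfaceFlux

/-! ### Partial derivatives of functions on spacetime -/

/-! On solutions `T` equals `Curl Θ`, so Stokes' theorem turns the flux of `T` through any regular
surface into the circulation of `Θ` around its boundary. Everything then concerns the circulation.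
Since the time interval is open and connected, being a constant of motion is the exact negation of
being time dependent, so global triviality means "time dependent or identically zero". A closed
surface has no free edges and its circulation vanishes, which gives (i).

For (ii), global non-triviality makes every boundary circulation conserved and not identically zero.
Applied to arbitrarily small flat squares in the three coordinate orientations, conservation forces
the continuous field `Curl Θ` itself to be constant in time (`eq_of_surfaceIntegral_flatSquare_eq`,
`totalDt_curl_eq_zero`). A density that is a total gradient on solutions would have zero
circulation, which is excluded.

Two supports are needed: total derivatives must become ordinary partial derivatives on solutions
(`partialDeriv_diffFun_jet`), and Stokes must hold for glued patches
(`surfaceIntegral_spatialCurl`), by Green's theorem on each square and cancellation along glued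
edges. -/

theorem isSymmSndFDerivAt_of_contDiffAt {E F : Type*} [NormedAddCommGroup E] [NormedSpace ℝ E]
    [NormedAddCommGroup F] [NormedSpace ℝ F] {f : E → F} {x : E} (hf : ContDiffAt ℝ ∞ f x) :
    IsSymmSndFDerivAt ℝ f x :=
  hf.isSymmSndFDerivAt <| by
    rw [minSmoothness_of_isRCLikeNormedField]
    exact WithTop.coe_le_coe.2 le_top

section Partial

variable {U : Set Spacetime} {h h₁ h₂ : Spacetime → ℝ}

theorem ContDiffOn.partialDeriv (hU : IsOpen U) (hh : ContDiffOn ℝ ∞ h U) (i : Fin 4) :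
    ContDiffOn ℝ ∞ (partialDeriv i h) U :=
  (hh.fderiv_of_isOpen hU le_rfl).clm_apply contDiffOn_const

theorem partialDeriv_eqOn (hU : IsOpen U) (hh : Set.EqOn h₁ h₂ U) (i : Fin 4) :
    Set.EqOn (partialDeriv i h₁) (partialDeriv i h₂) U := fun z hz => by
  have : h₁ =ᶠ[nhds z] h₂ := hh.eventuallyEq_of_mem (hU.mem_nhds hz)
  simp only [partialDeriv, this.fderiv_eq]

theorem partialDeriv_comm (hU : IsOpen U) (hh : ContDiffOn ℝ ∞ h U) (i j : Fin 4) :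
    Set.EqOn (partialDeriv i (partialDeriv j h)) (partialDeriv j (partialDeriv i h)) U := by
  intro z hz
  have hsymm : IsSymmSndFDerivAt ℝ h z :=
    isSymmSndFDerivAt_of_contDiffAt (hh.contDiffAt (hU.mem_nhds hz))
  have hd : DifferentiableAt ℝ (fderiv ℝ h) z :=
    ((hh.fderiv_of_isOpen hU (m := ∞) le_rfl).contDiffAt (hU.mem_nhds hz)).differentiableAt
      (by simp)
  have key : ∀ k l, partialDeriv k (partialDeriv l h) z =
      fderiv ℝ (fderiv ℝ h) z (Pi.single k 1) (Pi.single l 1) := fun k l => by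
    have hl := (hd.hasFDerivAt.clm_apply
      (hasFDerivAt_const (Pi.single l (1 : ℝ) : Spacetime) z)).fderiv
    simp only [ContinuousLinearMap.comp_zero, zero_add] at hl
    exact congrArg (fun L => L (Pi.single k (1 : ℝ))) hl
  rw [key, key, hsymm]

theorem ContDiffOn.partialDeriv_iterate (hU : IsOpen U) (hh : ContDiffOn ℝ ∞ h U) (i : Fin 4)
    (n : ℕ) : ContDiffOn ℝ ∞ ((SurfaceFlux.partialDeriv i)^[n] h) U := by
  induction n with
  | zero => exact hh
  | succ n ih =>
    rw [Function.iterate_succ_apply']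
    exact ContDiffOn.partialDeriv hU ih i

theorem partialDeriv_iterate_eqOn (hU : IsOpen U) (hh : Set.EqOn h₁ h₂ U) (i : Fin 4) (n : ℕ) :
    Set.EqOn ((partialDeriv i)^[n] h₁) ((partialDeriv i)^[n] h₂) U := by
  induction n with
  | zero => exact hh
  | succ n ih =>
    rw [Function.iterate_succ_apply', Function.iterate_succ_apply']
    exact partialDeriv_eqOn hU ih i

theorem partialDeriv_iterate_comm (hU : IsOpen U) (hh : ContDiffOn ℝ ∞ h U) (i j : Fin 4)
    (n : ℕ) :
    Set.EqOn (partialDeriv i ((partialDeriv j)^[n] h)) ((partialDeriv j)^[n] (partialDeriv i h))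
      U := by
  induction n with
  | zero => exact fun _ _ => rfl
  | succ n ih =>
    rw [Function.iterate_succ_apply', Function.iterate_succ_apply']
    exact (partialDeriv_comm hU (ContDiffOn.partialDeriv_iterate hU hh j n) i j).trans
      (partialDeriv_eqOn hU ih j)

theorem ContDiffOn.mixedPartial (hU : IsOpen U) (hh : ContDiffOn ℝ ∞ h U) (K : MultiIndex) :
    ContDiffOn ℝ ∞ (mixedPartial K h) U :=
  ContDiffOn.partialDeriv_iterate hU (ContDiffOn.partialDeriv_iterate hU
    (ContDiffOn.partialDeriv_iterate hU (ContDiffOn.partialDeriv_iterate hU hh 3 _) 2 _) 1 _) 0 _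

/-- `mixedPartial` differentiates in a fixed coordinate order, so a new derivative must be commuted
inwards past the blocks of lower index; `e0` to `e3` are these successive moves. -/
theorem partialDeriv_mixedPartial (hU : IsOpen U) (hh : ContDiffOn ℝ ∞ h U) (i : Fin 4)
    (K : MultiIndex) :
    Set.EqOn (partialDeriv i (mixedPartial K h)) (mixedPartial (K + Pi.single i 1) h) U := by
  have h3 := ContDiffOn.partialDeriv_iterate hU hh 3 (K 3)
  have h2 := ContDiffOn.partialDeriv_iterate hU h3 2 (K 2)
  have h1 := ContDiffOn.partialDeriv_iterate hU h2 1 (K 1)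
  have e0 := partialDeriv_iterate_comm hU h1 i 0 (K 0)
  have e1 := partialDeriv_iterate_eqOn hU (partialDeriv_iterate_comm hU h2 i 1 (K 1)) 0 (K 0)
  have e2 := partialDeriv_iterate_eqOn hU (partialDeriv_iterate_eqOn hU
    (partialDeriv_iterate_comm hU h3 i 2 (K 2)) 1 (K 1)) 0 (K 0)
  have e3 := partialDeriv_iterate_eqOn hU (partialDeriv_iterate_eqOn hU
    (partialDeriv_iterate_eqOn hU
    (partialDeriv_iterate_comm hU hh i 3 (K 3)) 2 (K 2)) 1 (K 1)) 0 (K 0)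
  fin_cases i
  · simpa [mixedPartial, Pi.single_apply] using e0
  · simpa [mixedPartial, Pi.single_apply] using e0.trans e1
  · simpa [mixedPartial, Pi.single_apply] using (e0.trans e1).trans e2
  · simpa [mixedPartial, Pi.single_apply] using ((e0.trans e1).trans e2).trans e3

end Partial

/-! ### Differential functions -/

section DiffFun

variable {m : ℕ} {D : Set (Jet m)}

/-- Coordinate projections are open: through each point there is a continuous section that changes
only the coordinates in `s`. Openness lets smoothness on the image yield genuine derivatives of the
representative `g`. -/
theorem isOpen_restrict_image (hD : IsOpen D) (s : Finset (Fin m × MultiIndex)) :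
    IsOpen (Jet.restrict s '' D) := by
  have h : IsOpenMap (fun (y : Fin m × MultiIndex → ℝ) (k : s) => y k) := by
    classical
    refine IsOpenMap.of_sections fun y => ⟨fun v k => if hk : k ∈ s then v ⟨k, hk⟩ else y k,
      ?_, ?_, ?_⟩
    · refine Continuous.continuousAt (continuous_pi fun k => ?_)
      by_cases hk : k ∈ s
      · simpa [hk] using continuous_apply _
      · simpa [hk] using continuous_const
    · funext k
      by_cases hk : k ∈ s <;> simp [hk]
    · intro v
      funext k
      simp
  exact (IsOpenMap.id.prodMap h) D hD

/-- The vector field on jet space along which `D_i` differentiates. -/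
def totalField (i : Fin 4) (w : Jet m) : Jet m :=
  (Pi.single i 1, fun k => w.2 (k.1, k.2 + Pi.single i 1))

/-- Jet space is infinite dimensional, but near `w` the line along the total field stays in `D`,
where `f` factors through finitely many coordinates; the line derivative is thus a
finite-dimensional one. -/
theorem totalDeriv_eq_fderiv (hD : IsOpen D) {f : Jet m → ℝ} {s : Finset (Fin m × MultiIndex)}
    {g : Spacetime × (s → ℝ) → ℝ} (hg : ContDiffOn ℝ ∞ g (Jet.restrict s '' D))
    (hf : ∀ w ∈ D, f w = g (Jet.restrict s w)) (i : Fin 4) {w : Jet m} (hw : w ∈ D) :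
    totalDeriv i f w = fderiv ℝ g (Jet.restrict s w) (Jet.restrict s (totalField i w)) := by
  have hgd : DifferentiableAt ℝ g (Jet.restrict s w) :=
    (hg.contDiffAt ((isOpen_restrict_image hD s).mem_nhds ⟨w, hw, rfl⟩)).differentiableAt
      (by simp)
  have hcont : Continuous fun t : ℝ => w + t • totalField i w := by fun_prop
  have hev : ∀ᶠ t in nhds (0 : ℝ), w + t • totalField i w ∈ D :=
    hcont.continuousAt.eventually_mem (hD.mem_nhds (by simpa using hw))
  have heq : (fun t : ℝ => f (w + t • totalField i w)) =ᶠ[nhds 0]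
      fun t => g (Jet.restrict s w + t • Jet.restrict s (totalField i w)) := by
    filter_upwards [hev] with t ht
    exact hf _ ht
  have := (hgd.hasFDerivAt.hasLineDerivAt (Jet.restrict s (totalField i w))).lineDeriv
  rw [← this]
  exact heq.deriv_eq

theorem IsDiffFun.totalDeriv (hD : IsOpen D) {f : Jet m → ℝ} (hf : IsDiffFun D f) (i : Fin 4) :
    IsDiffFun D (totalDeriv i f) := by
  classical
  obtain ⟨s, g, hg, hfg⟩ := hf
  -- A total derivative raises the order by one, so the shifted variables join those of `f`.
  let shift : Fin m × MultiIndex → Fin m × MultiIndex := fun k => (k.1, k.2 + Pi.single i 1)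
  let s' := s ∪ s.image shift
  have h1 : ∀ k ∈ s, k ∈ s' := fun k hk => Finset.mem_union_left _ hk
  have h2 : ∀ k ∈ s, shift k ∈ s' := fun k hk =>
    Finset.mem_union_right _ (Finset.mem_image_of_mem _ hk)
  let ρ : Spacetime × (s' → ℝ) → Spacetime × (s → ℝ) := fun q => (q.1, fun k => q.2 ⟨k, h1 k k.2⟩)
  let τ : Spacetime × (s' → ℝ) → Spacetime × (s → ℝ) := fun q =>
    (Pi.single i 1, fun k => q.2 ⟨shift k, h2 k k.2⟩)
  have hρ : ContDiff ℝ ∞ ρ := by fun_prop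
  have hτ : ContDiff ℝ ∞ τ := by fun_prop
  refine ⟨s', fun q => fderiv ℝ g (ρ q) (τ q), ?_, fun w hw => ?_⟩
  · refine ContDiffOn.clm_apply ?_ hτ.contDiffOn
    refine (hg.fderiv_of_isOpen (isOpen_restrict_image hD s) le_rfl).comp hρ.contDiffOn ?_
    rintro _ ⟨w, hw, rfl⟩
    exact ⟨w, hw, rfl⟩
  · exact totalDeriv_eq_fderiv hD hg hfg i hw

theorem IsDiffFun.sub {f g : Jet m → ℝ} (hf : IsDiffFun D f) (hg : IsDiffFun D g) :
    IsDiffFun D (fun w => f w - g w) := by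
  classical
  obtain ⟨s, f', hf', hff⟩ := hf
  obtain ⟨r, g', hg', hgg⟩ := hg
  let ρ : Spacetime × (↥(s ∪ r) → ℝ) → Spacetime × (s → ℝ) := fun q =>
    (q.1, fun k => q.2 ⟨k, Finset.mem_union_left _ k.2⟩)
  let τ : Spacetime × (↥(s ∪ r) → ℝ) → Spacetime × (r → ℝ) := fun q =>
    (q.1, fun k => q.2 ⟨k, Finset.mem_union_right _ k.2⟩)
  have hρ : ContDiff ℝ ∞ ρ := by fun_prop
  have hτ : ContDiff ℝ ∞ τ := by fun_prop
  refine ⟨s ∪ r, fun q => f' (ρ q) - g' (τ q), ?_, fun w hw => ?_⟩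
  · refine (hf'.comp hρ.contDiffOn ?_).sub (hg'.comp hτ.contDiffOn ?_)
    · rintro _ ⟨w, hw, rfl⟩
      exact ⟨w, hw, rfl⟩
    · rintro _ ⟨w, hw, rfl⟩
      exact ⟨w, hw, rfl⟩
  · exact congrArg₂ (· - ·) (hff w hw) (hgg w hw)

theorem IsVecDiffFun.curl (hD : IsOpen D) {f : Jet m → Space} (hf : IsVecDiffFun D f) :
    IsVecDiffFun D (Curl f) := by
  intro j
  fin_cases j
  · exact ((hf 2).totalDeriv hD 2).sub ((hf 1).totalDeriv hD 3)
  · exact ((hf 0).totalDeriv hD 3).sub ((hf 2).totalDeriv hD 1)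
  · exact ((hf 1).totalDeriv hD 1).sub ((hf 0).totalDeriv hD 2)

end DiffFun

/-! ### Evaluation of differential functions on solutions -/

namespace PDESystem

variable {m : ℕ} {P : PDESystem m} {u : Spacetime → Fin m → ℝ}

theorem isOpen_slab (P : PDESystem m) : IsOpen P.slab :=
  P.time_open.preimage (continuous_apply 0)

theorem contDiffOn_restrict_jet (hu : u ∈ P.solutions) (s : Finset (Fin m × MultiIndex)) :
    ContDiffOn ℝ ∞ (fun z => Jet.restrict s (jet u z)) P.slab := by
  refine contDiffOn_id.prodMk (contDiffOn_pi.2 fun k => ?_)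
  exact ContDiffOn.mixedPartial P.isOpen_slab ((contDiffOn_pi.1 hu.1) k.1.1) _

/-- The value of a differential function on a solution is smooth. -/
theorem contDiffOn_diffFun_jet (hu : u ∈ P.solutions) {f : Jet m → ℝ}
    (hf : IsDiffFun P.dom f) : ContDiffOn ℝ ∞ (fun z => f (jet u z)) P.slab := by
  obtain ⟨s, g, hg, hfg⟩ := hf
  exact (hg.comp (contDiffOn_restrict_jet hu s) fun z hz => ⟨_, (hu.2 z hz).1, rfl⟩).congr
    fun z hz => hfg _ (hu.2 z hz).1

/-- Total derivatives evaluate on solutions to partial derivatives. -/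
theorem partialDeriv_diffFun_jet (hu : u ∈ P.solutions) {f : Jet m → ℝ}
    (hf : IsDiffFun P.dom f) (i : Fin 4) {z : Spacetime} (hz : z ∈ P.slab) :
    partialDeriv i (fun z => f (jet u z)) z = totalDeriv i f (jet u z) := by
  obtain ⟨s, g, hg, hfg⟩ := hf
  have hU := P.isOpen_slab
  have hgd : DifferentiableAt ℝ g (Jet.restrict s (jet u z)) :=
    (hg.contDiffAt ((isOpen_restrict_image P.dom_open s).mem_nhds
      ⟨_, (hu.2 z hz).1, rfl⟩)).differentiableAt (by simp)
  have hcomp : ∀ k : s, ContDiffOn ℝ ∞ (fun y => mixedPartial k.1.2 (fun y => u y k.1.1) y)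
      P.slab := fun k => ContDiffOn.mixedPartial hU ((contDiffOn_pi.1 hu.1) k.1.1) _
  have hjd : HasFDerivAt (fun z => Jet.restrict s (jet u z))
      ((ContinuousLinearMap.id ℝ Spacetime).prod (ContinuousLinearMap.pi fun k : s =>
        fderiv ℝ (mixedPartial k.1.2 (fun y => u y k.1.1)) z)) z := by
    refine (hasFDerivAt_id z).prodMk (hasFDerivAt_pi.2 fun k => ?_)
    exact (((hcomp k).contDiffAt (hU.mem_nhds hz)).differentiableAt (by simp)).hasFDerivAt
  have heq : (fun z => f (jet u z)) =ᶠ[nhds z] fun z => g (Jet.restrict s (jet u z)) := by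
    filter_upwards [hU.mem_nhds hz] with y hy
    exact hfg _ (hu.2 y hy).1
  have hcd : fderiv ℝ (fun z => g (Jet.restrict s (jet u z))) z = _ :=
    (hgd.hasFDerivAt.comp z hjd).fderiv
  rw [totalDeriv_eq_fderiv P.dom_open hg hfg i (hu.2 z hz).1, partialDeriv, heq.fderiv_eq, hcd,
    ContinuousLinearMap.comp_apply]
  -- The chain rule leaves the derivative of the restricted jet along the `i`-th axis; it is the
  -- restricted total field, because differentiating `∂^K u` raises the multi-index by one.
  congr 1
  refine Prod.ext rfl (funext fun k => ?_)
  exact partialDeriv_mixedPartial hU ((contDiffOn_pi.1 hu.1) k.1.1) i k.1.2 hz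

end PDESystem

/-! ### Stokes' theorem for regular surfaces -/

/-- The classical curl of a vector field on space. -/
def spatialCurl (F : Space → Space) : Space → Space := fun x =>
  ![fderiv ℝ F x (Pi.single 1 1) 2 - fderiv ℝ F x (Pi.single 2 1) 1,
    fderiv ℝ F x (Pi.single 2 1) 0 - fderiv ℝ F x (Pi.single 0 1) 2,
    fderiv ℝ F x (Pi.single 0 1) 1 - fderiv ℝ F x (Pi.single 1 1) 0]

/-- The curl is the exterior derivative of the 1-form dual to `F`; this form separates the two
derivative terms needed for Green's theorem. -/
theorem spatialCurl_dotProduct_cross (F : Space → Space) (x a b : Space) :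
    spatialCurl F x ⬝ᵥ (a ⨯₃ b) = fderiv ℝ F x a ⬝ᵥ b - fderiv ℝ F x b ⬝ᵥ a := by
  have key : ∀ v : Space, fderiv ℝ F x v = v 0 • fderiv ℝ F x (Pi.single 0 1) +
      v 1 • fderiv ℝ F x (Pi.single 1 1) + v 2 • fderiv ℝ F x (Pi.single 2 1) := fun v => by
    have hv : v = v 0 • Pi.single 0 1 + v 1 • Pi.single 1 1 + v 2 • Pi.single 2 1 := by
      ext j
      fin_cases j <;> simp
    conv_lhs => rw [hv]
    simp only [map_add, map_smul]
  rw [key a, key b, cross_apply]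
  simp only [spatialCurl, dotProduct, Fin.sum_univ_three, Matrix.cons_val, Pi.add_apply,
    Pi.smul_apply, smul_eq_mul]
  ring

/-- The component of `F` along the derivative of the parametrization `σ` in the direction `v`. -/
def pullback (F : Space → Space) (σ : ℝ × ℝ → Space) (v : ℝ × ℝ) (p : ℝ × ℝ) : ℝ :=
  F (σ p) ⬝ᵥ fderiv ℝ σ p v

section Pullback

variable {F : Space → Space} {σ : ℝ × ℝ → Space}

theorem contDiff_pullback (hF : ContDiff ℝ ∞ F) (hσ : ContDiff ℝ ∞ σ) (v : ℝ × ℝ) :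
    ContDiff ℝ ∞ (pullback F σ v) := by
  have h1 : ContDiff ℝ ∞ fun p => F (σ p) := hF.comp hσ
  have h2 : ContDiff ℝ ∞ fun p => fderiv ℝ σ p v :=
    (hσ.fderiv_right le_rfl).clm_apply contDiff_const
  have h3 : ContDiff ℝ ∞ fun p => ∑ j, F (σ p) j * fderiv ℝ σ p v j :=
    ContDiff.sum fun j _ => (contDiff_pi.1 h1 j).mul (contDiff_pi.1 h2 j)
  exact h3

theorem fderiv_pullback (hF : ContDiff ℝ ∞ F) (hσ : ContDiff ℝ ∞ σ) (v w p : ℝ × ℝ) :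
    fderiv ℝ (pullback F σ v) p w = fderiv ℝ F (σ p) (fderiv ℝ σ p w) ⬝ᵥ fderiv ℝ σ p v +
      F (σ p) ⬝ᵥ fderiv ℝ (fderiv ℝ σ) p w v := by
  have h1 : HasFDerivAt (fun p => F (σ p)) ((fderiv ℝ F (σ p)).comp (fderiv ℝ σ p)) p :=
    (hF.differentiable (by simp) _).hasFDerivAt.comp p
      (hσ.differentiable (by simp) _).hasFDerivAt
  have h2 : HasFDerivAt (fun p => fderiv ℝ σ p v) ((fderiv ℝ (fderiv ℝ σ) p).flip v) p := by
    have hd : DifferentiableAt ℝ (fderiv ℝ σ) p :=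
      (hσ.fderiv_right (m := ∞) le_rfl).differentiable (by simp) _
    have := hd.hasFDerivAt.clm_apply (hasFDerivAt_const v p)
    simpa using this
  have h3 := HasFDerivAt.fun_sum (u := Finset.univ) fun (j : Fin 3) _ =>
    (hasFDerivAt_pi'.1 h1 j).mul (hasFDerivAt_pi'.1 h2 j)
  have h4 : fderiv ℝ (pullback F σ v) p = _ := h3.fderiv
  rw [h4]
  simp [dotProduct, Fin.sum_univ_three]
  ring

/-- Stokes' theorem for one patch. -/
theorem integral_spatialCurl_patch (hF : ContDiff ℝ ∞ F) (hσ : ContDiff ℝ ∞ σ) :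
    ∫ p in unitSquare, spatialCurl F (σ p) ⬝ᵥ
        ((fderiv ℝ σ p (1, 0)) ⨯₃ (fderiv ℝ σ p (0, 1))) =
      (∫ s in (0 : ℝ)..1, pullback F σ (1, 0) (s, 0)) +
      (∫ s in (0 : ℝ)..1, pullback F σ (0, 1) (1, s)) -
      (∫ s in (0 : ℝ)..1, pullback F σ (1, 0) (s, 1)) -
      ∫ s in (0 : ℝ)..1, pullback F σ (0, 1) (0, s) := by
  set f := pullback F σ (0, 1) with hf
  set g := fun p => -pullback F σ (1, 0) p with hg
  have hfs : ContDiff ℝ ∞ f := contDiff_pullback hF hσ _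
  have hgs : ContDiff ℝ ∞ g := (contDiff_pullback hF hσ _).neg
  have hsq : unitSquare = Set.Icc ((0 : ℝ), (0 : ℝ)) (1, 1) := Set.Icc_prod_Icc _ _ _ _
  have hint : ∀ p, spatialCurl F (σ p) ⬝ᵥ ((fderiv ℝ σ p (1, 0)) ⨯₃ (fderiv ℝ σ p (0, 1))) =
      fderiv ℝ f p (1, 0) + fderiv ℝ g p (0, 1) := fun p => by
    have hsymm : IsSymmSndFDerivAt ℝ σ p := isSymmSndFDerivAt_of_contDiffAt hσ.contDiffAt
    -- The terms with second derivatives of `σ` cancel by symmetry, leaving the antisymmetrized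
    -- derivative of `F`.
    rw [spatialCurl_dotProduct_cross, hg, fderiv_fun_neg, neg_apply, hf,
      fderiv_pullback hF hσ, fderiv_pullback hF hσ, hsymm (1, 0) (0, 1)]
    ring
  have hcont : Continuous fun p => fderiv ℝ f p (1, 0) + fderiv ℝ g p (0, 1) :=
    ((hfs.continuous_fderiv (by simp)).clm_apply continuous_const).add
      ((hgs.continuous_fderiv (by simp)).clm_apply continuous_const)
  have key := MeasureTheory.integral_divergence_prod_Icc_of_hasFDerivAt_of_le f g
    (fderiv ℝ f) (fderiv ℝ g) (0, 0) (1, 1) (by simp) hfs.continuous.continuousOn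
    hgs.continuous.continuousOn
    (fun x _ => (hfs.differentiable (by simp) x).hasFDerivAt)
    (fun x _ => (hgs.differentiable (by simp) x).hasFDerivAt)
    (hcont.continuousOn.integrableOn_compact isCompact_Icc)
  simp only [hint, hsq]
  rw [key]
  simp only [hg, intervalIntegral.integral_neg]
  ring

end Pullback

/-! ### Passing from single patches to the glued surface -/

namespace RegularSurface

variable (S : RegularSurface)

/-- The line integral of `F` along an edge of a patch. -/
def edgeIntegral (F : Space → Space) (a : Fin S.n × Fin 4) : ℝ :=
  ∫ s in (0 : ℝ)..1,
    F (S.patch a.1 (side a.2 s)) ⬝ᵥ deriv (fun r => S.patch a.1 (side a.2 r)) s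

theorem sum_edgeIntegral_patch {F : Space → Space} (hF : ContDiff ℝ ∞ F) (i : Fin S.n) :
    ∑ k, S.edgeIntegral F (i, k) =
      ∫ p in unitSquare, spatialCurl F (S.patch i p) ⬝ᵥ
        ((fderiv ℝ (S.patch i) p (1, 0)) ⨯₃ (fderiv ℝ (S.patch i) p (0, 1))) := by
  have hd : ∀ {c : ℝ → ℝ × ℝ} {c' : ℝ × ℝ} {s : ℝ}, HasDerivAt c c' s →
      deriv (fun r => S.patch i (c r)) s = fderiv ℝ (S.patch i) (c s) c' := fun {c c' s} hc =>
    (((S.smooth i).differentiable (by simp) _).hasFDerivAt.comp_hasDerivAt s hc).deriv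
  have e0 : S.edgeIntegral F (i, 0) = ∫ s in (0 : ℝ)..1, pullback F (S.patch i) (1, 0) (s, 0) :=
    intervalIntegral.integral_congr fun s _ => congrArg (F (S.patch i (s, 0)) ⬝ᵥ ·)
      (hd ((hasDerivAt_id s).prodMk (hasDerivAt_const s (0 : ℝ))))
  have e1 : S.edgeIntegral F (i, 1) = ∫ s in (0 : ℝ)..1, pullback F (S.patch i) (0, 1) (1, s) :=
    intervalIntegral.integral_congr fun s _ => congrArg (F (S.patch i (1, s)) ⬝ᵥ ·)
      (hd ((hasDerivAt_const s (1 : ℝ)).prodMk (hasDerivAt_id s)))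
  have hneg : ∀ (p v : ℝ × ℝ), pullback F (S.patch i) (-v) p = -pullback F (S.patch i) v p :=
    fun p v => by simp [pullback]
  have e2 : S.edgeIntegral F (i, 2) =
      -∫ s in (0 : ℝ)..1, pullback F (S.patch i) (1, 0) (s, 1) := by
    have h : S.edgeIntegral F (i, 2) =
        ∫ s in (0 : ℝ)..1, pullback F (S.patch i) (-(1, 0)) (1 - s, 1) :=
      intervalIntegral.integral_congr fun s _ => congrArg (F (S.patch i (1 - s, 1)) ⬝ᵥ ·)
        ((hd (((hasDerivAt_id s).const_sub 1).prodMk (hasDerivAt_const s (1 : ℝ)))).trans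
          (by simp))
    rw [h]
    simp only [hneg, intervalIntegral.integral_neg]
    rw [intervalIntegral.integral_comp_sub_left (fun s => pullback F (S.patch i) (1, 0) (s, 1))]
    simp
  have e3 : S.edgeIntegral F (i, 3) =
      -∫ s in (0 : ℝ)..1, pullback F (S.patch i) (0, 1) (0, s) := by
    have h : S.edgeIntegral F (i, 3) =
        ∫ s in (0 : ℝ)..1, pullback F (S.patch i) (-(0, 1)) (0, 1 - s) :=
      intervalIntegral.integral_congr fun s _ => congrArg (F (S.patch i (0, 1 - s)) ⬝ᵥ ·)
        ((hd ((hasDerivAt_const s (0 : ℝ)).prodMk ((hasDerivAt_id s).const_sub 1))).trans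
          (by simp))
    rw [h]
    simp only [hneg, intervalIntegral.integral_neg]
    rw [intervalIntegral.integral_comp_sub_left (fun s => pullback F (S.patch i) (0, 1) (0, s))]
    simp
  rw [Fin.sum_univ_four, e0, e1, e2, e3, integral_spatialCurl_patch hF (S.smooth i)]
  ring

theorem edgeIntegral_glue (F : Space → Space) {a : Fin S.n × Fin 4} (ha : S.glue a ≠ a) :
    S.edgeIntegral F (S.glue a) = -S.edgeIntegral F a := by
  have hev : ∀ s ∈ Set.Ioo (0 : ℝ) 1,
      (fun r => S.patch (S.glue a).1 (side (S.glue a).2 r)) =ᶠ[nhds s]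
        fun r => S.patch a.1 (side a.2 (1 - r)) := fun s hs => by
    filter_upwards [Ioo_mem_nhds hs.1 hs.2] with r hr
    exact S.glue_edge a ha r (Set.Ioo_subset_Icc_self hr)
  have h : S.edgeIntegral F (S.glue a) = ∫ s in (0 : ℝ)..1,
      -(F (S.patch a.1 (side a.2 (1 - s))) ⬝ᵥ
        deriv (fun r => S.patch a.1 (side a.2 r)) (1 - s)) := by
    unfold edgeIntegral
    -- The edges are matched only for parameters in `[0, 1]`, so their derivatives are compared on
    -- the open interval; the end points are null.
    rw [intervalIntegral.integral_of_le zero_le_one, intervalIntegral.integral_of_le zero_le_one,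
      MeasureTheory.integral_Ioc_eq_integral_Ioo, MeasureTheory.integral_Ioc_eq_integral_Ioo]
    refine MeasureTheory.setIntegral_congr_fun measurableSet_Ioo fun s hs => ?_
    have := S.glue_edge a ha s (Set.Ioo_subset_Icc_self hs)
    simp only [(hev s hs).deriv_eq, this]
    rw [deriv_comp_const_sub (f := fun r => S.patch a.1 (side a.2 r)), dotProduct_neg]
  rw [h, intervalIntegral.integral_neg, intervalIntegral.integral_comp_sub_left
    (fun s => F (S.patch a.1 (side a.2 s)) ⬝ᵥ deriv (fun r => S.patch a.1 (side a.2 r)) s)]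
  simp [edgeIntegral]

/-- Stokes' theorem. -/
theorem surfaceIntegral_spatialCurl {F : Space → Space} (hF : ContDiff ℝ ∞ F) :
    S.surfaceIntegral (spatialCurl F) = S.boundaryIntegral F := by
  classical
  have hglued : ∑ a with ¬ S.glue a = a, S.edgeIntegral F a = 0 := by
    -- Glued edges are traversed in opposite directions, so they cancel in pairs.
    refine Finset.sum_involution (fun a _ => S.glue a) ?_ ?_ ?_ ?_
    · intro a ha
      rw [S.edgeIntegral_glue F (Finset.mem_filter.1 ha).2, add_neg_cancel]
    · intro a ha _
      exact (Finset.mem_filter.1 ha).2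
    · intro a ha
      have := (Finset.mem_filter.1 ha).2
      simpa [S.glue_glue, eq_comm] using this
    · exact fun a _ => S.glue_glue a
  have htotal : ∑ a, S.edgeIntegral F a = S.surfaceIntegral (spatialCurl F) := by
    rw [Fintype.sum_prod_type]
    exact Finset.sum_congr rfl fun i _ => S.sum_edgeIntegral_patch hF i
  rw [← htotal, ← Finset.sum_filter_add_sum_filter_not _ (fun a => S.glue a = a), hglued,
    add_zero]
  unfold boundaryIntegral edgeIntegral
  congr!

theorem boundaryIntegral_of_closed (hS : S.Closed) (F : Space → Space) :
    S.boundaryIntegral F = 0 :=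
  Finset.sum_eq_zero fun a ha => absurd (Finset.mem_filter.1 ha).2 (hS a)

end RegularSurface

/-! ### Flat squares -/

/-- The linear embedding of the plane that maps the standard basis to `e_{j+1}`, `e_{j+2}`. -/
def squareMap (j : Fin 3) : ℝ × ℝ →L[ℝ] Space :=
  (ContinuousLinearMap.fst ℝ ℝ ℝ).smulRight (Pi.single (j + 1) 1) +
    (ContinuousLinearMap.snd ℝ ℝ ℝ).smulRight (Pi.single (j + 2) 1)

theorem squareMap_injective (j : Fin 3) : Function.Injective (squareMap j) := by
  intro p q h
  have h1 := congrFun h (j + 1)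
  have h2 := congrFun h (j + 2)
  fin_cases j <;> simp [squareMap] at h1 h2 <;> exact Prod.ext h1 h2

/-- Index addition wraps around modulo 3, so `j`, `j + 1`, `j + 2` is a cyclic, right-handed order.
-/
theorem squareMap_cross (j : Fin 3) :
    squareMap j (1, 0) ⨯₃ squareMap j (0, 1) = Pi.single j 1 := by
  rw [cross_apply]
  ext k
  fin_cases j <;> fin_cases k <;> simp [squareMap]

theorem hasFDerivAt_flatPatch (x : Space) (ε : ℝ) (j : Fin 3) (p : ℝ × ℝ) :
    HasFDerivAt (fun p => x + ε • squareMap j p) (ε • squareMap j) p :=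
  ((squareMap j).hasFDerivAt.const_smul ε).const_add x

theorem isConnected_unitSquare : IsConnected unitSquare :=
  (isConnected_Icc zero_le_one).prod (isConnected_Icc zero_le_one)

/-- The flat square with corner `x`, side length `ε` and unit normal `e_j`. -/
def flatSquare (x : Space) (ε : ℝ) (hε : 0 < ε) (j : Fin 3) : RegularSurface where
  n := 1
  patch _ p := x + ε • squareMap j p
  smooth _ := contDiff_const.add ((squareMap j).contDiff.const_smul ε)
  injective _ := fun p _ q _ h =>
    squareMap_injective j (smul_right_injective _ hε.ne' (add_left_cancel h))
  immersive _ p _ := by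
    rw [(hasFDerivAt_flatPatch x ε j p).fderiv]
    exact fun p q h => squareMap_injective j (smul_right_injective _ hε.ne' h)
  -- All four edges are free, so the square is not closed.
  glue := id
  glue_glue _ := rfl
  glue_edge a ha := absurd rfl ha
  meet i i' _ _ := by
    rw [Subsingleton.elim i i']
  connected := by
    rw [Set.iUnion_const]
    exact isConnected_unitSquare.image _
      (continuous_const.add ((squareMap j).continuous.const_smul ε)).continuousOn

theorem flatSquare_not_closed (x : Space) (ε : ℝ) (hε : 0 < ε) (j : Fin 3) :
    ¬ (flatSquare x ε hε j).Closed :=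
  fun h => h ((0 : Fin 1), 0) rfl

theorem surfaceIntegral_flatSquare (x : Space) (ε : ℝ) (hε : 0 < ε) (j : Fin 3)
    (F : Space → Space) : (flatSquare x ε hε j).surfaceIntegral F =
      ε ^ 2 * ∫ p in unitSquare, F (x + ε • squareMap j p) j := by
  have h : (flatSquare x ε hε j).surfaceIntegral F =
      ∑ _i : Fin 1, ∫ p in unitSquare, F (x + ε • squareMap j p) ⬝ᵥ
        ((fderiv ℝ (fun p => x + ε • squareMap j p) p (1, 0)) ⨯₃
          (fderiv ℝ (fun p => x + ε • squareMap j p) p (0, 1))) := rfl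
  rw [h, Fin.sum_univ_one, ← MeasureTheory.integral_const_mul]
  refine MeasureTheory.integral_congr_ae (Filter.Eventually.of_forall fun p => ?_)
  simp only [(hasFDerivAt_flatPatch x ε j p).fderiv, smul_apply, map_smul,
    LinearMap.smul_apply, squareMap_cross, dotProduct_smul, dotProduct_single, smul_eq_mul]
  ring

theorem volume_real_unitSquare : MeasureTheory.volume.real unitSquare = 1 := by
  rw [unitSquare, MeasureTheory.Measure.volume_eq_prod, MeasureTheory.measureReal_prod_prod]
  simp

/-- Continuous vector fields with equal fluxes through all flat squares are equal. -/
theorem eq_of_surfaceIntegral_flatSquare_eq {F G : Space → Space} (hF : Continuous F)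
    (hG : Continuous G) (h : ∀ x ε (hε : 0 < ε) j,
      (flatSquare x ε hε j).surfaceIntegral F = (flatSquare x ε hε j).surfaceIntegral G) :
    F = G := by
  funext x j
  by_contra hne
  set d : Space → ℝ := fun y => F y j - G y j with hd
  have hdc : Continuous d :=
    ((continuous_apply j).comp hF).sub ((continuous_apply j).comp hG)
  have hdx : 0 < |d x| := abs_pos.2 (sub_ne_zero.2 hne)
  obtain ⟨δ, hδ, hball⟩ := Metric.continuous_iff.1 hdc x (|d x| / 2) (half_pos hdx)
  -- The whole square lies in the ball where `d` differs from `d x` by less than `|d x| / 2`. Its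
  -- mean over the square is zero, so `|d x| ≤ |d x| / 2`, a contradiction.
  obtain ⟨ε, hε, hεδ⟩ : ∃ ε : ℝ, 0 < ε ∧ ε * ‖squareMap j‖ < δ := by
    have hpos : 0 < ‖squareMap j‖ + 1 := by positivity
    refine ⟨δ / (‖squareMap j‖ + 1), div_pos hδ hpos, ?_⟩
    rw [div_mul_eq_mul_div, div_lt_iff₀ hpos]
    nlinarith
  have hcompact : IsCompact unitSquare := isCompact_Icc.prod isCompact_Icc
  have hpatch : Continuous fun p : ℝ × ℝ => x + ε • squareMap j p := by fun_prop
  have hint : ∀ {f : Space → ℝ}, Continuous f → MeasureTheory.IntegrableOn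
      (fun p => f (x + ε • squareMap j p)) unitSquare := fun {f} hf =>
    (hf.comp hpatch).continuousOn.integrableOn_compact hcompact
  have hzero : ∫ p in unitSquare, d (x + ε • squareMap j p) = 0 := by
    have := h x ε hε j
    rw [surfaceIntegral_flatSquare, surfaceIntegral_flatSquare] at this
    have hFG := mul_left_cancel₀ (pow_ne_zero 2 hε.ne') this
    exact (MeasureTheory.integral_sub (hint ((continuous_apply j).comp hF))
      (hint ((continuous_apply j).comp hG))).trans (sub_eq_zero.2 hFG)
  have hbound : ‖∫ p in unitSquare, (d (x + ε • squareMap j p) - d x)‖ ≤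
      |d x| / 2 * MeasureTheory.volume.real unitSquare := by
    refine MeasureTheory.norm_setIntegral_le_of_norm_le_const hcompact.measure_lt_top
      fun p hp => ?_
    refine (hball _ ?_).le
    have hp1 : ‖p‖ ≤ 1 := by
      simp only [unitSquare, Set.mem_prod, Set.mem_Icc] at hp
      refine max_le ?_ ?_ <;> rw [Real.norm_eq_abs, abs_le] <;> constructor <;> linarith
    calc dist (x + ε • squareMap j p) x = ε * ‖squareMap j p‖ := by
          rw [dist_eq_norm, add_sub_cancel_left, norm_smul, Real.norm_of_nonneg hε.le]
      _ ≤ ε * ‖squareMap j‖ := by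
          gcongr
          simpa using (squareMap j).le_opNorm_of_le hp1
      _ < δ := hεδ
  rw [MeasureTheory.integral_sub (hint hdc)
    (MeasureTheory.integrableOn_const hcompact.measure_lt_top.ne), hzero,
    MeasureTheory.setIntegral_const, volume_real_unitSquare] at hbound
  simp only [zero_sub, one_smul, mul_one, norm_neg, Real.norm_eq_abs] at hbound
  linarith

/-! ### Differential functions on solutions at a fixed time -/

theorem hasFDerivAt_spacetimePoint (t : ℝ) (x : Space) :
    ∃ L : Space →L[ℝ] Spacetime, HasFDerivAt (spacetimePoint t) L x ∧
      ∀ k, L (Pi.single k 1) = Pi.single k.succ 1 := by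
  refine ⟨ContinuousLinearMap.pi (Fin.cons 0 fun k => ContinuousLinearMap.proj k), ?_, ?_⟩
  · refine hasFDerivAt_pi.2 fun i => ?_
    refine Fin.cases ?_ (fun k => ?_) i
    · exact hasFDerivAt_const t x
    · exact hasFDerivAt_apply k x
  · intro k
    ext i
    refine Fin.cases ?_ (fun l => ?_) i
    · simp [(Fin.succ_ne_zero k).symm]
    · simp [Pi.single_apply]

theorem contDiff_spacetimePoint (t : ℝ) : ContDiff ℝ ∞ (spacetimePoint t) :=
  contDiff_pi.2 fun i => Fin.cases contDiff_const (fun k => contDiff_apply ℝ ℝ k) i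

theorem fderiv_slice_apply {H : Spacetime → Space} {t : ℝ} {x : Space}
    (hH : DifferentiableAt ℝ H (spacetimePoint t x)) (k j : Fin 3) :
    fderiv ℝ (fun y => H (spacetimePoint t y)) x (Pi.single k 1) j =
      partialDeriv k.succ (fun z => H z j) (spacetimePoint t x) := by
  obtain ⟨L, hL, hLk⟩ := hasFDerivAt_spacetimePoint t x
  have h1 : fderiv ℝ (fun y => H (spacetimePoint t y)) x =
      (fderiv ℝ H (spacetimePoint t x)).comp L := (hH.hasFDerivAt.comp x hL).fderiv
  have h2 := (hasFDerivAt_pi'.1 hH.hasFDerivAt j).fderiv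
  rw [h1, partialDeriv, h2, ContinuousLinearMap.comp_apply, hLk]
  rfl

namespace PDESystem

variable {m : ℕ} {P : PDESystem m} {u : Spacetime → Fin m → ℝ} {t : ℝ}

theorem spacetimePoint_mem_slab (ht : t ∈ P.time) (x : Space) : spacetimePoint t x ∈ P.slab :=
  ht

theorem contDiffOn_vecDiffFun_jet (hu : u ∈ P.solutions) {f : Jet m → Space}
    (hf : IsVecDiffFun P.dom f) : ContDiffOn ℝ ∞ (fun z => f (jet u z)) P.slab :=
  contDiffOn_pi.2 fun j => contDiffOn_diffFun_jet hu (hf j)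

theorem contDiff_slice (hu : u ∈ P.solutions) (ht : t ∈ P.time) {f : Jet m → Space}
    (hf : IsVecDiffFun P.dom f) : ContDiff ℝ ∞ fun x => f (jet u (spacetimePoint t x)) :=
  (contDiffOn_vecDiffFun_jet hu hf).comp_contDiff (contDiff_spacetimePoint t)
    (spacetimePoint_mem_slab ht)

theorem fderiv_slice_diffFun (hu : u ∈ P.solutions) (ht : t ∈ P.time) {f : Jet m → Space}
    (hf : IsVecDiffFun P.dom f) (x : Space) (k j : Fin 3) :
    fderiv ℝ (fun y => f (jet u (spacetimePoint t y))) x (Pi.single k 1) j =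
      totalDeriv k.succ (fun w => f w j) (jet u (spacetimePoint t x)) := by
  have hz := spacetimePoint_mem_slab ht x
  rw [fderiv_slice_apply (H := fun z => f (jet u z))
    (((contDiffOn_vecDiffFun_jet hu hf).contDiffAt (P.isOpen_slab.mem_nhds hz)).differentiableAt
      (by simp))]
  exact partialDeriv_diffFun_jet hu (hf j) _ hz

/-- The total curl evaluates on solutions to the classical curl. -/
theorem spatialCurl_slice (hu : u ∈ P.solutions) (ht : t ∈ P.time) {f : Jet m → Space}
    (hf : IsVecDiffFun P.dom f) :
    spatialCurl (fun x => f (jet u (spacetimePoint t x))) =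
      fun x => Curl f (jet u (spacetimePoint t x)) := by
  funext x
  simp only [spatialCurl, Curl, fderiv_slice_diffFun hu ht hf]
  rfl

/-- On a solution both total derivatives become partial derivatives of one smooth function, and
these commute. -/
theorem spatialCurl_slice_grad (hu : u ∈ P.solutions) (ht : t ∈ P.time) {Ξ : Jet m → ℝ}
    (hΞ : IsDiffFun P.dom Ξ) :
    spatialCurl (fun x => Grad Ξ (jet u (spacetimePoint t x))) = 0 := by
  have hΞu := contDiffOn_diffFun_jet hu hΞ
  have hgrad : ∀ j : Fin 3, (fun w => Grad Ξ w j) = totalDeriv j.succ Ξ := fun j => by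
    fin_cases j <;> rfl
  have hvec : IsVecDiffFun P.dom (Grad Ξ) := fun j => by
    rw [hgrad]
    exact hΞ.totalDeriv P.dom_open _
  have key : ∀ x (k j : Fin 3),
      fderiv ℝ (fun y => Grad Ξ (jet u (spacetimePoint t y))) x (Pi.single k 1) j =
        partialDeriv k.succ (partialDeriv j.succ fun z => Ξ (jet u z)) (spacetimePoint t x) := by
    intro x k j
    have hz := spacetimePoint_mem_slab ht x
    rw [fderiv_slice_diffFun hu ht hvec, hgrad,
      ← partialDeriv_diffFun_jet hu (hΞ.totalDeriv P.dom_open _) _ hz]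
    exact partialDeriv_eqOn P.isOpen_slab
      (fun y hy => (partialDeriv_diffFun_jet hu hΞ j.succ hy).symm) _ hz
  have hcomm : ∀ x (k j : Fin 3),
      partialDeriv k.succ (partialDeriv j.succ fun z => Ξ (jet u z)) (spacetimePoint t x) =
        partialDeriv j.succ (partialDeriv k.succ fun z => Ξ (jet u z)) (spacetimePoint t x) :=
    fun x k j => partialDeriv_comm P.isOpen_slab hΞu _ _ (spacetimePoint_mem_slab ht x)
  funext x
  simp only [spatialCurl, key]
  rw [hcomm x 1 2, hcomm x 2 0, hcomm x 0 1]
  ext j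
  fin_cases j <;> simp

/-- Stokes' theorem for the flux of a total curl on solutions. -/
theorem fluxThrough_curl (S : RegularSurface) (hu : u ∈ P.solutions) (ht : t ∈ P.time)
    {f : Jet m → Space} (hf : IsVecDiffFun P.dom f) :
    S.fluxThrough (Curl f) u t = S.circulation f u t := by
  rw [RegularSurface.circulation, ← S.surfaceIntegral_spatialCurl (contDiff_slice hu ht hf),
    spatialCurl_slice hu ht hf, RegularSurface.fluxThrough]

theorem circulation_grad (S : RegularSurface) (hu : u ∈ P.solutions) (ht : t ∈ P.time)
    {f : Jet m → Space} {Ξ : Jet m → ℝ} (hf : IsVecDiffFun P.dom f) (hΞ : IsDiffFun P.dom Ξ)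
    (h : P.EqOnSolutions f (Grad Ξ)) : S.circulation f u t = 0 := by
  have hslice : (fun x => f (jet u (spacetimePoint t x))) =
      fun x => Grad Ξ (jet u (spacetimePoint t x)) :=
    funext fun x => h u hu _ (spacetimePoint_mem_slab ht x)
  rw [RegularSurface.circulation, ← S.surfaceIntegral_spatialCurl (contDiff_slice hu ht hf),
    hslice, spatialCurl_slice_grad hu ht hΞ]
  simp [RegularSurface.surfaceIntegral]

/-! ### Constants of motion -/

/-- A zero derivative on an open connected interval forces constancy; conversely, constancy near `t`
gives the zero derivative without any differentiability assumption. -/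
theorem isConstantOfMotion_iff {C : (Spacetime → Fin m → ℝ) → ℝ → ℝ} :
    P.IsConstantOfMotion C ↔ ¬ P.TimeDependent C := by
  constructor
  · rintro h ⟨u, hu, t₁, h₁, t₂, h₂, hne⟩
    refine hne (P.time_open.is_const_of_deriv_eq_zero P.time_interval.isPreconnected
      (fun t ht => (h u hu t ht).differentiableAt.differentiableWithinAt)
      (fun t ht => (h u hu t ht).deriv) h₁ h₂)
  · intro h u hu t ht
    refine (hasDerivAt_const t (C u t)).congr_of_eventuallyEq ?_
    filter_upwards [P.time_open.mem_nhds ht] with s hs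
    by_contra hne
    exact h ⟨u, hu, s, hs, t, ht, hne⟩

theorem timeDependent_congr {C C' : (Spacetime → Fin m → ℝ) → ℝ → ℝ}
    (h : ∀ u ∈ P.solutions, ∀ t ∈ P.time, C u t = C' u t) :
    P.TimeDependent C ↔ P.TimeDependent C' := by
  constructor
  · rintro ⟨u, hu, t₁, h₁, t₂, h₂, hne⟩
    exact ⟨u, hu, t₁, h₁, t₂, h₂, by rwa [← h u hu t₁ h₁, ← h u hu t₂ h₂]⟩
  · rintro ⟨u, hu, t₁, h₁, t₂, h₂, hne⟩
    exact ⟨u, hu, t₁, h₁, t₂, h₂, by rwa [h u hu t₁ h₁, h u hu t₂ h₂]⟩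

theorem identicallyZero_congr {C C' : (Spacetime → Fin m → ℝ) → ℝ → ℝ}
    (h : ∀ u ∈ P.solutions, ∀ t ∈ P.time, C u t = C' u t) :
    P.IdenticallyZero C ↔ P.IdenticallyZero C' :=
  forall₂_congr fun u hu => forall₂_congr fun t ht => by rw [h u hu t ht]

/-- If the circulation of `Θ` around all flat squares is conserved, so is `Curl Θ`. -/
theorem totalDt_curl_eq_zero {Θ : Jet m → Space} (hΘ : IsVecDiffFun P.dom Θ)
    (h : ∀ x ε (hε : 0 < ε) j, ¬ P.TimeDependent ((flatSquare x ε hε j).circulation Θ)) :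
    P.EqOnSolutions (totalDt (Curl Θ)) 0 := by
  intro u hu z hz
  -- By Stokes the conserved circulations are the fluxes of `Curl Θ` through flat squares, and these
  -- determine the field at each time.
  have hconst : ∀ s ∈ P.time, (fun x => Curl Θ (jet u (spacetimePoint s x))) =
      fun x => Curl Θ (jet u (spacetimePoint (z 0) x)) := fun s hs => by
    have hc : ∀ r ∈ P.time, Continuous fun x => Curl Θ (jet u (spacetimePoint r x)) :=
      fun r hr => (contDiff_slice hu hr (hΘ.curl P.dom_open)).continuous
    refine eq_of_surfaceIntegral_flatSquare_eq (hc s hs) (hc _ hz) fun x ε hε j => ?_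
    have hs' := fluxThrough_curl (flatSquare x ε hε j) hu hs hΘ
    have hz' := fluxThrough_curl (flatSquare x ε hε j) hu hz hΘ
    refine hs'.trans (Eq.trans ?_ hz'.symm)
    by_contra hne
    exact h x ε hε j ⟨u, hu, s, hs, z 0, hz, hne⟩
  have hpoint : ∀ r : ℝ, z + r • (Pi.single 0 1 : Spacetime) =
      spacetimePoint (z 0 + r) (Fin.tail z) := fun r => by
    funext i
    refine Fin.cases ?_ (fun k => ?_) i
    · simp [spacetimePoint]
    · simp [spacetimePoint, Fin.tail]
  funext j
  have hj := hΘ.curl P.dom_open j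
  have hd : DifferentiableAt ℝ (fun y => Curl Θ (jet u y) j) z :=
    ((contDiffOn_diffFun_jet hu hj).contDiffAt (P.isOpen_slab.mem_nhds hz)).differentiableAt
      (by simp)
  have hev : (fun r : ℝ => Curl Θ (jet u (z + r • (Pi.single 0 1 : Spacetime))) j) =ᶠ[nhds 0]
      fun _ => Curl Θ (jet u (spacetimePoint (z 0) (Fin.tail z))) j := by
    have hmem : ∀ᶠ r in nhds (0 : ℝ), z 0 + r ∈ P.time :=
      (continuous_const.add continuous_id).continuousAt.eventually_mem
        (P.time_open.mem_nhds (by simpa using show z 0 ∈ P.time from hz))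
    filter_upwards [hmem] with r hr
    rw [hpoint]
    exact congrFun (congrFun (hconst _ hr) (Fin.tail z)) j
  calc totalDeriv 0 (fun w => Curl Θ w j) (jet u z)
      = partialDeriv 0 (fun y => Curl Θ (jet u y) j) z :=
        (partialDeriv_diffFun_jet hu hj 0 hz).symm
    _ = lineDeriv ℝ (fun y => Curl Θ (jet u y) j) z (Pi.single 0 1) :=
        hd.lineDeriv_eq_fderiv.symm
    _ = 0 := by
        rw [lineDeriv, hev.deriv_eq]
        simp

end PDESystem

end SurfaceFlux

end

/-! ### The proposition -/

theorem mainTheorem5 {m : ℕ} (P : SurfaceFlux.PDESystem m)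
    (T X Θ : SurfaceFlux.Jet m → SurfaceFlux.Space) (Λ : SurfaceFlux.Jet m → ℝ)
    (hlaw : P.IsSurfaceFluxLaw T X) (htriv : P.HasTrivialForm T X Θ Λ) :
    (∀ S : SurfaceFlux.RegularSurface,
      P.GloballyTrivial T X S ↔
        S.Closed ∨
          (¬ S.Closed ∧
            (P.TimeDependent (S.circulation Θ) ∨ P.IdenticallyZero (S.circulation Θ)))) ∧
    ((∀ S : SurfaceFlux.RegularSurface, ¬ S.Closed → ¬ P.GloballyTrivial T X S) →
      P.EqOnSolutions (SurfaceFlux.totalDt (SurfaceFlux.Curl Θ)) 0 ∧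
      ∀ S : SurfaceFlux.RegularSurface, ¬ S.Closed →
        (∀ u ∈ P.solutions, ∀ t ∈ P.time, S.fluxThrough T u t = S.circulation Θ u t) ∧
        P.IsNontrivialCirculatoryConstant Θ S) := by
  obtain ⟨hΘ, hΛ, hT, hX⟩ := htriv
  have hflux : ∀ S : SurfaceFlux.RegularSurface, ∀ u ∈ P.solutions, ∀ t ∈ P.time,
      S.fluxThrough T u t = S.circulation Θ u t := fun S u hu t ht => by
    rw [← SurfaceFlux.PDESystem.fluxThrough_curl S hu ht hΘ]
    exact congrArg S.surfaceIntegral (funext fun x => hT u hu _ ht)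
  have hglob : ∀ S : SurfaceFlux.RegularSurface, P.GloballyTrivial T X S ↔
      (P.TimeDependent (S.circulation Θ) ∨ P.IdenticallyZero (S.circulation Θ)) := fun S => by
    rw [SurfaceFlux.PDESystem.GloballyTrivial,
      and_iff_right (show P.LocallyTrivial T X from ⟨Θ, Λ, hΘ, hΛ, hT, hX⟩),
      SurfaceFlux.PDESystem.isConstantOfMotion_iff,
      SurfaceFlux.PDESystem.timeDependent_congr (hflux S),
      SurfaceFlux.PDESystem.identicallyZero_congr (hflux S), or_iff_not_imp_left]
  refine ⟨fun S => ?_, fun h => ?_⟩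
  · by_cases hS : S.Closed
    · have hzero : P.IdenticallyZero (S.circulation Θ) :=
        fun u _ t _ => S.boundaryIntegral_of_closed hS _
      simp only [hglob S, hS, hzero, or_true, true_or]
    · simp only [hglob S, hS, not_false_eq_true, true_and, false_or]
  · have hnt : ∀ S : SurfaceFlux.RegularSurface, ¬ S.Closed →
        ¬ P.TimeDependent (S.circulation Θ) ∧ ¬ P.IdenticallyZero (S.circulation Θ) :=
      fun S hS => not_or.1 fun hor => h S hS ((hglob S).2 hor)
    -- Flat squares are non-closed surfaces, so the hypothesis applies to all of them.
    refine ⟨SurfaceFlux.PDESystem.totalDt_curl_eq_zero hΘ fun x ε hε j =>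
      (hnt _ (SurfaceFlux.flatSquare_not_closed x ε hε j)).1, fun S hS => ⟨hflux S, ?_⟩⟩
    refine ⟨SurfaceFlux.PDESystem.isConstantOfMotion_iff.2 (hnt S hS).1, (hnt S hS).2, ?_⟩
    rintro ⟨Ξ, hΞ, hgrad⟩
    exact (hnt S hS).2 fun u hu t ht =>
      SurfaceFlux.PDESystem.circulation_grad S hu ht hΘ hΞ hgrad
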